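/- Let $t\ge 1$, let $\mathcal W_1,\dots,\mathcal W_t,\mathcal Y_1,\dots,\mathcal Y_t$ be finite alphabets, and let $q$ be a pmf on $\mathcal W_1\times\cdots\times\mathcal W_t\times\mathcal Y_1\times\cdots\times\mathcal Y_t$; write $(W_1,\dots,W_t,Y_1,\dots,Y_t)$ for random variables with pmf $q$, and put $X=(W_1,\dots,W_t)$, $\mathcal X=\mathcal W_1\times\cdots\times\mathcal W_t$. For $n\ge 1$, a code of block length $n$ consists of finite sets $\mathcal M_1,\dots,\mathcal M_t$, an encoder $f:\mathcal X^n\to\mathcal M_1\times\cdots\times\mathcal M_t$ and decoders $g_l:\mathcal M_1\times\cdots\times\mathcal M_l\times\mathcal Y_l^n\to\mathcal W_l^n$, $l=1,\dots,t$. Let $(W_{1,i},\dots,W_{t,i},Y_{1,i},\dots,Y_{t,i})$, $i=1,\dots,n$, be drawn iid according to $q$, let $X_i=(W_{1,i},\dots,W_{t,i})$, let $(M_1,\dots,M_t)=f(X_1,\dots,X_n)$, and let $(\hat W_{l,1},\dots,\hat W_{l,n})=g_l(M_1,\dots,M_l,Y_{l,1},\dots,Y_{l,n})$. The average symbol error probability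 at decoder $l$ is $P_e^l=\frac1n\sum_{i=1}^n\Pr[\hat W_{l,i}\ne W_{l,i}]$, and the rate on channel $l$ is $\kappa_l=\frac1n\log_2|\mathcal M_l|$. A tuple $(r_1,\dots,r_t)$ of non-negative reals is called $(0,\dots,0)$-admissible if for every $\epsilon>0$ there are an $n\ge1$ and a code of block length $n$ with $P_e^l\le\epsilon$ and $\kappa_l\le r_l+\epsilon$ for all $l=1,\dots,t$. Define $$R(0,\dots,0)=\min\{r\ge 0:\ (r,0,\dots,0)\text{ is }(0,\dots,0)\text{-admissible}\}.$$ If the side-information is degraded, i.e. $(W_1,\dots,W_t)\to Y_t\to Y_{t-1}\to\cdots\to Y_1$ is a Markov chain under $q$, then this minimum exists and $$R(0,\dots,0)=\sum_{l=1}^t H\big(W_l\,\big|\,W_1,\dots,W_{l-1},Y_l\big),$$ where $H$ denotes (conditional) entropy in bits. -/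

import Mathlib

noncomputable section

namespace SideInfo

/-! ### Random variables on a finite sample space `Ω` with pmf `p : Ω → ℝ` -/

open Classical in
/-- The pmf of the random variable `A` under `p`: `a ↦ Pr[A = a]`. -/
def law {Ω α : Type*} [Fintype Ω] (p : Ω → ℝ) (A : Ω → α) (a : α) : ℝ :=
  ∑ ω with A ω = a, p ω

/-- The conditional entropy `H(A | B)` in bits. -/
def condEntropy {Ω α β : Type*} [Fintype Ω] [Fintype α] [Fintype β]
    (p : Ω → ℝ) (A : Ω → α) (B : Ω → β) : ℝ :=
  -∑ a, ∑ b, law p (fun ω => (A ω, B ω)) (a, b) *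
    Real.logb 2 (law p (fun ω => (A ω, B ω)) (a, b) / law p B b)

open Classical in
/-- `A`, `B`, `C` form a Markov chain, in this order, under `p`. -/
def IsMarkov {Ω α β γ : Type*} [Fintype Ω]
    (p : Ω → ℝ) (A : Ω → α) (B : Ω → β) (C : Ω → γ) : Prop :=
  ∀ a b c, law p (fun ω => (A ω, B ω, C ω)) (a, b, c) =
    if 0 < law p B b then
      law p (fun ω => (A ω, B ω)) (a, b) * law p (fun ω => (B ω, C ω)) (b, c) / law p B b
    else 0

/-! ### Successive refinement with side-information

Decoders are indexed by `Fin t`, so decoder `l` of `1, …, t` is `l - 1 : Fin t`. The source symbol and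
the side-information symbols `(x, y_1, …, y_t)` have joint pmf `q` on `X × (∀ l, Y l)`. -/

/-- A code of block length `n`. The message set of channel `l` is a finite set of size `m l`; decoder
`l` sees the messages of the channels `k ≤ l` and its own side-information. -/
structure Code {t : ℕ} (X : Type*) (Y Xhat : Fin t → Type*) (n : ℕ) where
  m : Fin t → ℕ
  enc : (Fin n → X) → ∀ l, Fin (m l)
  dec : ∀ l, (∀ k : {k : Fin t // k ≤ l}, Fin (m k)) → (Fin n → Y l) → Fin n → Xhat l

/-- The rate on channel `l`, in bits per source symbol. -/
def Code.rate {t : ℕ} {X : Type*} {Y Xhat : Fin t → Type*} {n : ℕ}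
    (c : Code X Y Xhat n) (l : Fin t) : ℝ :=
  1 / (n : ℝ) * Real.logb 2 (c.m l)

/-- The replica that decoder `l` produces from the source block `x` and its side-information `y`. -/
def Code.replica {t : ℕ} {X : Type*} {Y Xhat : Fin t → Type*} {n : ℕ}
    (c : Code X Y Xhat n) (l : Fin t) (x : Fin n → X) (y : Fin n → Y l) : Fin n → Xhat l :=
  c.dec l (fun k => c.enc x k) y

/-- The average distortion at decoder `l` when the `n` source and side-information tuples are iid
with pmf `q`. -/
def Code.distortion {t : ℕ} {X : Type*} {Y Xhat : Fin t → Type*} {n : ℕ}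
    [Fintype X] [∀ l, Fintype (Y l)] (c : Code X Y Xhat n)
    (q : X × (∀ l, Y l) → ℝ) (δ : ∀ l, X → Xhat l → ℝ) (l : Fin t) : ℝ :=
  ∑ s : Fin n → X × (∀ l, Y l), (∏ i, q (s i)) *
    (1 / (n : ℝ) * ∑ i, δ l (s i).1
      (c.replica l (fun j => (s j).1) (fun j => (s j).2 l) i))

/-- The set of `d`-admissible rate tuples. -/
def admissibleRegion {t : ℕ} {X : Type*} {Y Xhat : Fin t → Type*}
    [Fintype X] [∀ l, Fintype (Y l)]
    (q : X × (∀ l, Y l) → ℝ) (δ : ∀ l, X → Xhat l → ℝ) (d : Fin t → ℝ) : Set (Fin t → ℝ) :=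
  {r | (∀ l, 0 ≤ r l) ∧ ∀ ε > 0, ∃ n : ℕ, 0 < n ∧ ∃ c : Code X Y Xhat n,
    (∀ l, c.distortion q δ l ≤ d l + ε) ∧ ∀ l, c.rate l ≤ r l + ε}

/-- The rates `r ≥ 0` such that `(r, 0, …, 0)` is `d`-admissible. -/
def singleChannelRates {t : ℕ} {X : Type*} {Y Xhat : Fin t → Type*}
    [Fintype X] [∀ l, Fintype (Y l)]
    (q : X × (∀ l, Y l) → ℝ) (δ : ∀ l, X → Xhat l → ℝ) (d : Fin t → ℝ) : Set ℝ :=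
  {r | 0 ≤ r ∧ (fun l : Fin t => if (l : ℕ) = 0 then r else 0) ∈ admissibleRegion q δ d}

/-- The rate-distortion function `R(d)`: the least of `singleChannelRates q δ d`. It is written as
an infimum; that the minimum is attained is part of what is claimed about it. -/
def rateDistortion {t : ℕ} {X : Type*} {Y Xhat : Fin t → Type*}
    [Fintype X] [∀ l, Fintype (Y l)]
    (q : X × (∀ l, Y l) → ℝ) (δ : ∀ l, X → Xhat l → ℝ) (d : Fin t → ℝ) : ℝ :=
  sInf (singleChannelRates q δ d)

/-- Degraded side-information: `X, Y_t, Y_{t-1}, …, Y_1` is a Markov chain under `q`, i.e. for every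
`l` the past `(X, Y_t, …, Y_{l+1})`, the present `Y_l` and the future `(Y_{l-1}, …, Y_1)` form a
Markov chain. -/
def IsDegraded {t : ℕ} {X : Type*} {Y : Fin t → Type*} [Fintype X] [∀ l, Fintype (Y l)]
    (q : X × (∀ l, Y l) → ℝ) : Prop :=
  ∀ l : Fin t, IsMarkov q
    (fun ω => (ω.1, fun k : {k : Fin t // l < k} => ω.2 k))
    (fun ω => ω.2 l)
    (fun ω => fun k : {k : Fin t // k < l} => ω.2 k)

/-! ### Private messages: `X = (W_1, …, W_t)` and decoder `l` wants `W_l` -/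

open Classical in
/-- The symbol-error distortion measure of decoder `l`. -/
def symbolError {t : ℕ} {W : Fin t → Type*} (l : Fin t) (w : ∀ k, W k) (what : W l) : ℝ :=
  if w l = what then 0 else 1

end SideInfo

end

/-!
*Converse.* Each decoder, its message being fixed, gives by way of a symmetric channel a kernel from
what it knows to the block of `W_l`. The ratio of the product of these kernels to the product of the
true conditional laws has expectation at most `1`: the Markov property allows the factors to be
removed one at a time, the last decoder first. Summing over the messages and applying Jensen's
inequality bounds the sum of the entropies by the sum of the rates, up to a penalty as in Fano's
inequality that vanishes with the error probability.

*Achievability.* Each `W_k` is binned at random, at a rate slightly above `H(W_k | W_{<k}, Y_k)`,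
and all the bin indices are sent on the first channel. Decoder `l` recovers `W_1, …, W_l` in turn;
the rate of the `k`-th binning suffices for every decoder `l ≥ k` because the side-information is
degraded.
-/

noncomputable section

namespace SideInfo

section Probability

variable {Ω α β γ δ : Type*} [Fintype Ω] {p : Ω → ℝ}

open Classical in
/-- The probability of the event `E` under the pmf `p`; `law p A a` is `prob p (A · = a)`. -/
def prob (p : Ω → ℝ) (E : Ω → Prop) : ℝ := ∑ ω with E ω, p ω

open Classical in
theorem prob_eq_sum_ite (p : Ω → ℝ) (E : Ω → Prop) :
    prob p E = ∑ ω, if E ω then p ω else 0 :=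
  Finset.sum_filter _ _

theorem prob_mono (hp : ∀ ω, 0 ≤ p ω) {E F : Ω → Prop} (h : ∀ ω, 0 < p ω → E ω → F ω) :
    prob p E ≤ prob p F := by
  classical
  simp only [prob_eq_sum_ite]
  refine Finset.sum_le_sum fun ω _ => ?_
  rcases (hp ω).eq_or_lt with h0 | h0
  · simp [← h0]
  · have := h ω h0
    split_ifs <;> grind

theorem prob_exists_le (hp : ∀ ω, 0 ≤ p ω) {κ : Type*} [Fintype κ] (E : κ → Ω → Prop) :
    prob p (fun ω => ∃ i, E i ω) ≤ ∑ i, prob p (E i) := by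
  classical
  simp only [prob_eq_sum_ite]
  rw [Finset.sum_comm]
  refine Finset.sum_le_sum fun ω _ => ?_
  have hE : ∀ i, 0 ≤ if E i ω then p ω else 0 := fun i => by split_ifs <;> simp [hp ω]
  split_ifs with h
  · obtain ⟨i, hi⟩ := h
    simpa [hi] using Finset.single_le_sum (fun i _ => hE i) (Finset.mem_univ i)
  · exact Finset.sum_nonneg fun i _ => hE i

theorem prob_or_le (hp : ∀ ω, 0 ≤ p ω) (E F : Ω → Prop) :
    prob p (fun ω => E ω ∨ F ω) ≤ prob p E + prob p F := by
  have h := prob_exists_le hp fun b : Bool => cond b E F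
  simpa [or_comm] using h

theorem law_nonneg (hp : ∀ ω, 0 ≤ p ω) (A : Ω → α) (a : α) : 0 ≤ law p A a :=
  Finset.sum_nonneg fun ω _ => hp ω

theorem law_pos (hp : ∀ ω, 0 ≤ p ω) (A : Ω → α) {ω : Ω} (hω : 0 < p ω) : 0 < law p A (A ω) :=
  Finset.sum_pos' (fun ω _ => hp ω) ⟨ω, by simp, hω⟩

theorem law_mono (hp : ∀ ω, 0 ≤ p ω) {A : Ω → α} {B : Ω → β} {a : α} {b : β}
    (h : ∀ ω, A ω = a → B ω = b) : law p A a ≤ law p B b :=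
  prob_mono hp fun ω _ => h ω

theorem law_congr (p : Ω → ℝ) {A : Ω → α} {B : Ω → β} {a : α} {b : β}
    (h : ∀ ω, A ω = a ↔ B ω = b) : law p A a = law p B b :=
  congrArg (prob p) (funext fun ω => propext (h ω))

open Classical in
theorem law_eq_sum_ite (p : Ω → ℝ) (A : Ω → α) (a : α) :
    law p A a = ∑ ω, if A ω = a then p ω else 0 :=
  prob_eq_sum_ite p (A · = a)

theorem sum_law_mul [Fintype α] (p : Ω → ℝ) (A : Ω → α) (g : α → ℝ) :
    ∑ a, law p A a * g a = ∑ ω, p ω * g (A ω) := by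
  classical
  simp only [law_eq_sum_ite, Finset.sum_mul, ite_mul, zero_mul]
  rw [Finset.sum_comm]
  simp only [Finset.sum_ite_eq, Finset.mem_univ, if_true]

open Classical in
theorem law_comp_prodMk (p : Ω → ℝ) (A : Ω → α) (B : Ω → β) (f : α → γ) (c : γ) (b : β) :
    law p (fun ω => (f (A ω), B ω)) (c, b) =
      ∑ a ∈ Finset.univ.image A with f a = c, law p (fun ω => (A ω, B ω)) (a, b) := by
  simp only [law_eq_sum_ite, Prod.mk.injEq]
  rw [Finset.sum_comm]
  refine Finset.sum_congr rfl fun ω _ => ?_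
  by_cases h : B ω = b <;> simp [h]

theorem sum_law_prodMk [Fintype α] (p : Ω → ℝ) (A : Ω → α) (B : Ω → β) (b : β) :
    ∑ a, law p (fun ω => (A ω, B ω)) (a, b) = law p B b := by
  classical
  simp only [law_eq_sum_ite, Prod.mk.injEq]
  rw [Finset.sum_comm]
  refine Finset.sum_congr rfl fun ω _ => ?_
  by_cases h : B ω = b <;> simp [h]

/-- The conditional probability `Pr[A = a | B = b]`, with the value `0` if `Pr[B = b] = 0`. -/
def condProb (p : Ω → ℝ) (A : Ω → α) (B : Ω → β) (a : α) (b : β) : ℝ :=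
  law p (fun ω => (A ω, B ω)) (a, b) / law p B b

theorem condProb_nonneg (hp : ∀ ω, 0 ≤ p ω) (A : Ω → α) (B : Ω → β) (a : α) (b : β) :
    0 ≤ condProb p A B a b :=
  div_nonneg (law_nonneg hp _ _) (law_nonneg hp _ _)

theorem condProb_le_one (hp : ∀ ω, 0 ≤ p ω) (A : Ω → α) (B : Ω → β) (a : α) (b : β) :
    condProb p A B a b ≤ 1 :=
  div_le_one_of_le₀ (law_mono hp fun _ h => (Prod.mk.inj h).2) (law_nonneg hp _ _)

theorem condProb_pos (hp : ∀ ω, 0 ≤ p ω) (A : Ω → α) (B : Ω → β) {ω : Ω} (hω : 0 < p ω) :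
    0 < condProb p A B (A ω) (B ω) :=
  div_pos (law_pos hp (fun ω => (A ω, B ω)) hω) (law_pos hp B hω)

theorem sum_condProb_le_one [Fintype α] (p : Ω → ℝ) (A : Ω → α) (B : Ω → β) (b : β) :
    ∑ a, condProb p A B a b ≤ 1 := by
  simp only [condProb, ← Finset.sum_div, sum_law_prodMk]
  exact div_self_le_one _

theorem law_mul_condProb (hp : ∀ ω, 0 ≤ p ω) (A : Ω → α) (B : Ω → β) (a : α) (b : β) :
    law p B b * condProb p A B a b = law p (fun ω => (A ω, B ω)) (a, b) :=
  mul_div_cancel_of_imp' fun h => le_antisymm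
    (h ▸ law_mono hp fun _ h => (Prod.mk.inj h).2) (law_nonneg hp _ _)

/-- Change of measure: replacing the conditional law of `A` given `B` by a subprobability kernel
`k` does not increase the expectation of a nonnegative function of `B`. -/
theorem sum_mul_div_condProb_le [Fintype α] [Finite β] (hp : ∀ ω, 0 ≤ p ω) (A : Ω → α) (B : Ω → β)
    {g : β → ℝ} (hg : ∀ b, 0 ≤ g b) {k : α → β → ℝ} (hk : ∀ a b, 0 ≤ k a b)
    (hk1 : ∀ b, ∑ a, k a b ≤ 1) :
    ∑ ω, p ω * (g (B ω) * (k (A ω) (B ω) / condProb p A B (A ω) (B ω))) ≤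
      ∑ ω, p ω * g (B ω) := by
  have := Fintype.ofFinite β
  rw [← sum_law_mul p (fun ω => (A ω, B ω)) fun x => g x.2 * (k x.1 x.2 / condProb p A B x.1 x.2),
    ← sum_law_mul p B g, Fintype.sum_prod_type_right]
  refine Finset.sum_le_sum fun b _ => ?_
  have hb : 0 ≤ law p B b * g b := mul_nonneg (law_nonneg hp _ _) (hg b)
  calc ∑ a, law p (fun ω => (A ω, B ω)) (a, b) * (g b * (k a b / condProb p A B a b))
      ≤ ∑ a, law p B b * g b * k a b := by
        refine Finset.sum_le_sum fun a _ => ?_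
        rw [← law_mul_condProb hp]
        rcases eq_or_ne (condProb p A B a b) 0 with h | h
        · simpa [h] using mul_nonneg hb (hk a b)
        · exact le_of_eq (by field_simp)
    _ ≤ law p B b * g b := by
        rw [← Finset.mul_sum]
        exact mul_le_of_le_one_right hb (hk1 b)

theorem exists_pos_of_mem_stdSimplex (hp : p ∈ stdSimplex ℝ Ω) : ∃ ω, 0 < p ω := by
  obtain ⟨ω, -, hω⟩ := Finset.exists_lt_of_sum_lt (s := Finset.univ) (f := 0) (g := p)
    (by simp [hp.2])
  exact ⟨ω, hω⟩

/-- Jensen's inequality for the logarithm, in which `F` need only be positive on the support. -/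
theorem sum_mul_logb_le_logb (hp : p ∈ stdSimplex ℝ Ω) {F : Ω → ℝ} (hF : ∀ ω, 0 < p ω → 0 < F ω)
    {N : ℝ} (hN : ∑ ω, p ω * F ω ≤ N) : ∑ ω, p ω * Real.logb 2 (F ω) ≤ Real.logb 2 N := by
  have hpF : ∀ ω, 0 ≤ p ω * F ω := fun ω => by
    rcases (hp.1 ω).eq_or_lt with h | h
    · simp [← h]
    · exact (mul_pos h (hF ω h)).le
  obtain ⟨ω₀, hω₀⟩ := exists_pos_of_mem_stdSimplex hp
  have hN0 : 0 < N := (Finset.sum_pos' (fun ω _ => hpF ω)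
    ⟨ω₀, Finset.mem_univ _, mul_pos hω₀ (hF _ hω₀)⟩).trans_le hN
  have hlog : ∀ ω, p ω * Real.log (F ω) ≤ p ω * Real.log N + (p ω * F ω / N - p ω) := fun ω => by
    rcases (hp.1 ω).eq_or_lt with h | h
    · simp [← h]
    have h1 := Real.log_le_sub_one_of_pos (div_pos (hF ω h) hN0)
    rw [Real.log_div (hF ω h).ne' hN0.ne'] at h1
    calc p ω * Real.log (F ω) ≤ p ω * (Real.log N + (F ω / N - 1)) := by gcongr; linarith
      _ = p ω * Real.log N + (p ω * F ω / N - p ω) := by ring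
  have hsum : ∑ ω, p ω * Real.log (F ω) ≤ Real.log N :=
    calc ∑ ω, p ω * Real.log (F ω) ≤ ∑ ω, (p ω * Real.log N + (p ω * F ω / N - p ω)) :=
          Finset.sum_le_sum fun ω _ => hlog ω
      _ = Real.log N + ((∑ ω, p ω * F ω) / N - 1) := by
          rw [Finset.sum_add_distrib, Finset.sum_sub_distrib, ← Finset.sum_mul, ← Finset.sum_div,
            hp.2, one_mul]
      _ ≤ Real.log N := by linarith [(div_le_one hN0).2 hN]
  simp only [Real.logb, ← mul_div_assoc, ← Finset.sum_div]
  exact div_le_div_of_nonneg_right hsum (Real.log_pos one_lt_two).le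

end Probability

section Entropy

variable {Ω α β γ : Type*} [Fintype Ω] {p : Ω → ℝ} [Fintype α] [Fintype β]

theorem condEntropy_eq_sum (p : Ω → ℝ) (A : Ω → α) (B : Ω → β) :
    condEntropy p A B = -∑ ω, p ω * Real.logb 2 (condProb p A B (A ω) (B ω)) := by
  rw [condEntropy, ← Fintype.sum_prod_type', ← sum_law_mul p (fun ω => (A ω, B ω))
    (fun x => Real.logb 2 (condProb p A B x.1 x.2))]
  rfl

theorem condEntropy_nonneg (hp : ∀ ω, 0 ≤ p ω) (A : Ω → α) (B : Ω → β) : 0 ≤ condEntropy p A B := by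
  rw [condEntropy_eq_sum, neg_nonneg]
  exact Finset.sum_nonpos fun ω _ => mul_nonpos_of_nonneg_of_nonpos (hp ω)
    (Real.logb_nonpos one_lt_two (condProb_nonneg hp _ _ _ _) (condProb_le_one hp _ _ _ _))

theorem condEntropy_comp_equiv [Fintype γ] (p : Ω → ℝ) (A : Ω → α) (B : Ω → β) (e : β ≃ γ) :
    condEntropy p A (fun ω => e (B ω)) = condEntropy p A B := by
  simp only [condEntropy_eq_sum, condProb]
  congr! 5 with ω
  all_goals exact law_congr p fun _ => by simp only [Prod.mk.injEq, e.apply_eq_iff_eq]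

/-- The ratio of the two conditional probabilities has expectation at most `1` by the change of
measure, so its logarithm has nonpositive expectation. -/
theorem condEntropy_le_condEntropy_comp [Fintype γ] (hp : p ∈ stdSimplex ℝ Ω) (A : Ω → α)
    (B : Ω → β) (f : β → γ) : condEntropy p A B ≤ condEntropy p A (fun ω => f (B ω)) := by
  have hratio : ∑ ω, p ω * (condProb p A (fun ω => f (B ω)) (A ω) (f (B ω)) /
      condProb p A B (A ω) (B ω)) ≤ 1 := by
    simpa [hp.2] using sum_mul_div_condProb_le hp.1 A B (g := fun _ => 1) (fun _ => zero_le_one)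
      (k := fun a b => condProb p A (fun ω => f (B ω)) a (f b))
      (fun _ _ => condProb_nonneg hp.1 _ _ _ _) (fun _ => sum_condProb_le_one _ _ _ _)
  have hpos : ∀ ω, 0 < p ω → 0 < condProb p A B (A ω) (B ω) := fun _ => condProb_pos hp.1 A B
  have hpos' : ∀ ω, 0 < p ω → 0 < condProb p A (fun ω => f (B ω)) (A ω) (f (B ω)) :=
    fun _ => condProb_pos hp.1 A fun ω => f (B ω)
  have hlog := sum_mul_logb_le_logb hp (fun ω hω => div_pos (hpos' ω hω) (hpos ω hω)) hratio
  rw [Real.logb_one] at hlog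
  rw [condEntropy_eq_sum, condEntropy_eq_sum, neg_le_neg_iff, ← sub_nonpos,
    ← Finset.sum_sub_distrib]
  refine le_of_eq_of_le (Finset.sum_congr rfl fun ω _ => ?_) hlog
  rcases (hp.1 ω).eq_or_lt with h | h
  · simp [← h]
  · rw [Real.logb_div (hpos' ω h).ne' (hpos ω h).ne', mul_sub]

end Entropy

section Markov

variable {Ω α β γ δ : Type*} [Fintype Ω] {p : Ω → ℝ} {A : Ω → α} {B : Ω → β} {C : Ω → γ}
  {D : Ω → δ}

theorem isMarkov_iff (hp : ∀ ω, 0 ≤ p ω) :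
    IsMarkov p A B C ↔ ∀ a b c, law p (fun ω => (A ω, B ω, C ω)) (a, b, c) * law p B b =
      law p (fun ω => (A ω, B ω)) (a, b) * law p (fun ω => (B ω, C ω)) (b, c) := by
  refine forall_congr' fun a => forall_congr' fun b => forall_congr' fun c => ?_
  split_ifs with hb
  · exact eq_div_iff hb.ne'
  · have hABC : law p (fun ω => (A ω, B ω, C ω)) (a, b, c) ≤ law p B b :=
      law_mono hp fun _ h => (Prod.mk.inj (Prod.mk.inj h).2).1
    have hBC : law p (fun ω => (B ω, C ω)) (b, c) ≤ law p B b :=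
      law_mono hp fun _ h => (Prod.mk.inj h).1
    rw [not_lt] at hb
    rw [le_antisymm (hABC.trans hb) (law_nonneg hp _ _),
      le_antisymm (hBC.trans hb) (law_nonneg hp _ _)]
    simp only [zero_mul, mul_zero]

theorem IsMarkov.comp_left (hp : ∀ ω, 0 ≤ p ω) (h : IsMarkov p A B C) (f : α → δ) :
    IsMarkov p (fun ω => f (A ω)) B C := by
  classical
  rw [isMarkov_iff hp] at h ⊢
  intro d b c
  rw [law_comp_prodMk p A (fun ω => (B ω, C ω)) f, law_comp_prodMk p A B f, Finset.sum_mul,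
    Finset.sum_mul]
  exact Finset.sum_congr rfl fun a _ => h a b c

theorem IsMarkov.comp_equiv (h : IsMarkov p A B C) {β' γ' : Type*} (e : β ≃ β') (e' : γ ≃ γ') :
    IsMarkov p A (fun ω => e (B ω)) (fun ω => e' (C ω)) := by
  intro a b c
  obtain ⟨b, rfl⟩ := e.surjective b
  obtain ⟨c, rfl⟩ := e'.surjective c
  convert h a b c using 4
  all_goals first
    | rfl
    | exact law_congr p fun _ => by simp only [Prod.mk.injEq, EmbeddingLike.apply_eq_iff_eq]

theorem IsMarkov.weak_union (hp : ∀ ω, 0 ≤ p ω) (h : IsMarkov p (fun ω => (A ω, D ω)) B C) :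
    IsMarkov p A (fun ω => (D ω, B ω)) C := by
  have hD := (isMarkov_iff hp).1 (h.comp_left hp Prod.snd)
  rw [isMarkov_iff hp] at h ⊢
  rintro a ⟨d, b⟩ c
  have hADBC : law p (fun ω => (A ω, (D ω, B ω), C ω)) (a, (d, b), c) =
      law p (fun ω => ((A ω, D ω), B ω, C ω)) ((a, d), b, c) :=
    law_congr p fun ω => by simp only [Prod.mk.injEq, and_assoc]
  have hADB : law p (fun ω => (A ω, D ω, B ω)) (a, d, b) =
      law p (fun ω => ((A ω, D ω), B ω)) ((a, d), b) :=
    law_congr p fun ω => by simp only [Prod.mk.injEq, and_assoc]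
  have hDBC : law p (fun ω => ((D ω, B ω), C ω)) ((d, b), c) =
      law p (fun ω => (D ω, B ω, C ω)) (d, b, c) :=
    law_congr p fun ω => by simp only [Prod.mk.injEq, and_assoc]
  rw [hADBC, hADB, hDBC]
  rcases (law_nonneg hp B b).eq_or_lt with hb | hb
  · have hDB : law p (fun ω => (D ω, B ω)) (d, b) = 0 :=
      le_antisymm (hb ▸ law_mono hp fun _ h => (Prod.mk.inj h).2) (law_nonneg hp _ _)
    have hADB0 : law p (fun ω => ((A ω, D ω), B ω)) ((a, d), b) = 0 :=
      le_antisymm (hb ▸ law_mono hp fun _ h => (Prod.mk.inj h).2) (law_nonneg hp _ _)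
    rw [hDB, hADB0, mul_zero, zero_mul]
  · refine mul_right_cancel₀ hb.ne' ?_
    linear_combination law p (fun ω => (D ω, B ω)) (d, b) * h (a, d) b c -
      law p (fun ω => ((A ω, D ω), B ω)) ((a, d), b) * hD d b c

theorem IsMarkov.condProb_eq (hp : ∀ ω, 0 ≤ p ω) (h : IsMarkov p A B C) {ω : Ω} (hω : 0 < p ω) :
    condProb p A (fun ω => (B ω, C ω)) (A ω) (B ω, C ω) = condProb p A B (A ω) (B ω) := by
  have hB : 0 < law p B (B ω) := law_pos hp B hω
  have hBC : 0 < law p (fun ω => (B ω, C ω)) (B ω, C ω) := law_pos hp (fun ω => (B ω, C ω)) hω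
  rw [condProb, h, if_pos hB, condProb]
  field_simp

theorem IsMarkov.condEntropy_eq [Fintype α] [Fintype β] [Fintype γ] (hp : ∀ ω, 0 ≤ p ω)
    (h : IsMarkov p A B C) : condEntropy p A (fun ω => (B ω, C ω)) = condEntropy p A B := by
  rw [condEntropy_eq_sum, condEntropy_eq_sum]
  congr! 2 with ω
  rcases (hp ω).eq_or_lt with h0 | h0
  · rw [← h0, zero_mul, zero_mul]
  · rw [h.condProb_eq hp h0]

end Markov

section Block

variable {Ω α β γ ι : Type*} [Fintype ι]

/-- The pmf of independent copies, indexed by `ι`, of a random variable with pmf `p`. -/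
def block (p : Ω → ℝ) (s : ι → Ω) : ℝ := ∏ i, p (s i)

theorem block_nonneg {p : Ω → ℝ} (hp : ∀ ω, 0 ≤ p ω) (s : ι → Ω) : 0 ≤ block p s :=
  Finset.prod_nonneg fun i _ => hp (s i)

theorem pos_of_block_pos {p : Ω → ℝ} (hp : ∀ ω, 0 ≤ p ω) {s : ι → Ω} (hs : 0 < block p s)
    (i : ι) : 0 < p (s i) :=
  (hp (s i)).lt_of_ne fun h => hs.ne' (Finset.prod_eq_zero (Finset.mem_univ i) h.symm)

variable [Fintype Ω] {p : Ω → ℝ}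

theorem block_mem_stdSimplex [DecidableEq ι] (hp : p ∈ stdSimplex ℝ Ω) :
    (block p : (ι → Ω) → ℝ) ∈ stdSimplex ℝ (ι → Ω) := by
  refine ⟨block_nonneg hp.1, ?_⟩
  simp only [block, ← Fintype.prod_sum, hp.2, Finset.prod_const_one]

theorem sum_block_mul_apply [DecidableEq ι] (hp : p ∈ stdSimplex ℝ Ω) (i : ι) (g : Ω → ℝ) :
    ∑ s : ι → Ω, block p s * g (s i) = ∑ ω, p ω * g ω := by
  have hs : ∀ s : ι → Ω, block p s * g (s i) = ∏ j, p (s j) * if j = i then g (s j) else 1 :=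
    fun s => by
      rw [Finset.prod_mul_distrib, Finset.prod_ite_eq' Finset.univ i, if_pos (Finset.mem_univ i),
        block]
  calc ∑ s : ι → Ω, block p s * g (s i) = ∏ j, ∑ ω, p ω * if j = i then g ω else 1 := by
        simp only [hs, Fintype.prod_sum]
    _ = ∏ j, if j = i then ∑ ω, p ω * g ω else 1 := by
        refine Finset.prod_congr rfl fun j _ => ?_
        split_ifs <;> simp only [mul_one, hp.2]
    _ = ∑ ω, p ω * g ω := by simp only [Finset.prod_ite_eq', Finset.mem_univ, if_true]

variable [DecidableEq ι]

theorem law_block (p : Ω → ℝ) (A : Ω → α) (a : ι → α) :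
    law (block p) (A ∘ ·) a = ∏ i, law p A (a i) := by
  classical
  simp only [law_eq_sum_ite, Fintype.prod_sum]
  refine Finset.sum_congr rfl fun s _ => ?_
  simp only [Finset.prod_ite_zero, block, funext_iff, Function.comp_apply, Finset.mem_univ,
    forall_const]

theorem law_block_prodMk (p : Ω → ℝ) (A : Ω → α) (B : Ω → β) (a : ι → α) (b : ι → β) :
    law (block p) (fun s => (A ∘ s, B ∘ s)) (a, b) =
      ∏ i, law p (fun ω => (A ω, B ω)) (a i, b i) := by
  rw [← law_block p (fun ω => (A ω, B ω)) fun i => (a i, b i)]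
  exact law_congr _ fun s => by
    simp only [Prod.mk.injEq, funext_iff, Function.comp_apply, forall_and]

theorem condProb_block (p : Ω → ℝ) (A : Ω → α) (B : Ω → β) (a : ι → α) (b : ι → β) :
    condProb (block p) (A ∘ ·) (B ∘ ·) a b = ∏ i, condProb p A B (a i) (b i) := by
  simp only [condProb, law_block_prodMk, law_block, Finset.prod_div_distrib]

theorem IsMarkov.block (hp : ∀ ω, 0 ≤ p ω) {A : Ω → α} {B : Ω → β} {C : Ω → γ}
    (h : IsMarkov p A B C) :
    IsMarkov (block p) (fun s : ι → Ω => A ∘ s) (fun s => B ∘ s) (fun s => C ∘ s) := by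
  rw [isMarkov_iff hp] at h
  refine (isMarkov_iff (block_nonneg hp)).2 fun a b c => ?_
  have hABC : law (SideInfo.block p) (fun s : ι → Ω => (A ∘ s, B ∘ s, C ∘ s)) (a, b, c) =
      ∏ i, law p (fun ω => (A ω, B ω, C ω)) (a i, b i, c i) := by
    rw [← law_block_prodMk p A (fun ω => (B ω, C ω)) a fun i => (b i, c i)]
    exact law_congr _ fun s => by
      simp only [Prod.mk.injEq, funext_iff, Function.comp_apply, forall_and]
  rw [hABC, law_block, law_block_prodMk, law_block_prodMk, ← Finset.prod_mul_distrib,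
    ← Finset.prod_mul_distrib]
  exact Finset.prod_congr rfl fun i _ => h _ _ _

theorem condEntropy_block [Fintype α] [Fintype β] (hp : p ∈ stdSimplex ℝ Ω) (A : Ω → α)
    (B : Ω → β) : condEntropy (block p) (fun s : ι → Ω => A ∘ s) (fun s => B ∘ s) =
      Fintype.card ι * condEntropy p A B := by
  have hlog : ∀ s : ι → Ω,
      block p s * Real.logb 2 (condProb (block p) (A ∘ ·) (B ∘ ·) (A ∘ s) (B ∘ s)) =
        ∑ i, block p s * Real.logb 2 (condProb p A B (A (s i)) (B (s i))) := fun s => by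
    rcases (block_nonneg hp.1 s).eq_or_lt with h | h
    · simp only [← h, zero_mul, Finset.sum_const_zero]
    · rw [condProb_block, Real.logb_prod, Finset.mul_sum]
      · rfl
      · exact fun i _ => (condProb_pos hp.1 A B (pos_of_block_pos hp.1 h i)).ne'
  rw [condEntropy_eq_sum, condEntropy_eq_sum, Finset.sum_congr rfl fun s _ => hlog s,
    Finset.sum_comm, Finset.sum_congr rfl fun i _ => sum_block_mul_apply hp i
      fun ω => Real.logb 2 (condProb p A B (A ω) (B ω))]
  simp only [Finset.sum_const, Finset.card_univ, nsmul_eq_mul, mul_neg]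

end Block

section Chain

variable {Ω ι : Type*} {α β : ι → Type*} [LinearOrder ι]

/-- The components of a family of random variables with index less than `l`. -/
def before (A : ∀ l, Ω → α l) (l : ι) (ω : Ω) (j : {j // j < l}) : α j := A j ω

/-- The pair of `before A l` and `B`: what a decoder with side-information `B` knows about the
components `A` of the source when it has recovered those preceding `A l`. -/
def known {β : Type*} (A : ∀ l, Ω → α l) (B : Ω → β) (l : ι) (ω : Ω) :
    (∀ j : {j // j < l}, α j) × β :=
  (before A l ω, B ω)

variable [Fintype Ω] {p : Ω → ℝ} {A : ∀ l, Ω → α l} {B : ∀ l, Ω → β l}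

/-- The factors are removed from the largest index downwards: by the Markov property the conditional
law of the last `A l` may be taken given all the variables on which the other factors depend. -/
theorem sum_mul_prod_div_condProb_le [Finite ι] [∀ l, Fintype (α l)] [∀ l, Finite (β l)]
    (hp : p ∈ stdSimplex ℝ Ω)
    (hM : ∀ l, IsMarkov p (A l) (known A (B l) l) (before B l)) {k : ∀ l, α l → β l → ℝ}
    (hk : ∀ l a b, 0 ≤ k l a b) (hk1 : ∀ l b, ∑ a, k l a b ≤ 1) (s : Finset ι) :
    ∑ ω, p ω * ∏ l ∈ s, k l (A l ω) (B l ω) /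
      condProb p (A l) (known A (B l) l) (A l ω) (known A (B l) l ω) ≤ 1 := by
  induction s using Finset.induction_on_max with
  | empty => simp [hp.2]
  | insert l s hl ih =>
    let g (b : ((∀ j : {j // j < l}, α j) × β l) × (∀ j : {j // j < l}, β j)) : ℝ :=
      ∏ j ∈ s.subtype (· < l), k j (b.1.1 j) (b.2 j) /
        condProb p (A j) (known A (B j) j) (b.1.1 j) (fun i => b.1.1 ⟨i, i.2.trans j.2⟩, b.2 j)
    have hg : ∀ ω, g (known A (B l) l ω, before B l ω) = ∏ j ∈ s, k j (A j ω) (B j ω) /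
        condProb p (A j) (known A (B j) j) (A j ω) (known A (B j) j ω) := fun ω =>
      Finset.prod_subtype_of_mem (fun j => k j (A j ω) (B j ω) /
        condProb p (A j) (known A (B j) j) (A j ω) (known A (B j) j ω)) hl
    have hg0 : ∀ b, 0 ≤ g b := fun b => Finset.prod_nonneg fun j _ =>
      div_nonneg (hk _ _ _) (condProb_nonneg hp.1 _ _ _ _)
    have hchange := sum_mul_div_condProb_le hp.1 (A l)
      (fun ω => (known A (B l) l ω, before B l ω)) hg0
      (k := fun a b => k l a b.1.2) (fun _ _ => hk _ _ _) (fun _ => hk1 _ _)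
    simp only [hg] at hchange
    refine le_trans (le_of_eq (Finset.sum_congr rfl fun ω _ => ?_)) (hchange.trans ih)
    rcases (hp.1 ω).eq_or_lt with h | h
    · rw [← h, zero_mul, zero_mul]
    · rw [Finset.prod_insert fun h => (hl l h).false, mul_comm (k l _ _ / _),
        (hM l).condProb_eq hp.1 h]
      rfl

/-- If the message is fixed, the likelihood ratio has expectation at most `1`; summing over all
messages and taking logarithms gives the bound. -/
theorem sum_condEntropy_add_le_logb_card [Fintype ι] [∀ l, Fintype (α l)] [∀ l, Fintype (β l)]
    (hp : p ∈ stdSimplex ℝ Ω)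
    (hM : ∀ l, IsMarkov p (A l) (known A (B l) l) (before B l)) {μ : Type*} [Fintype μ] (e : Ω → μ)
    {k : μ → ∀ l, α l → β l → ℝ} (hk : ∀ m l a b, 0 < k m l a b)
    (hk1 : ∀ m l b, ∑ a, k m l a b ≤ 1) :
    ∑ l, condEntropy p (A l) (known A (B l) l) +
        ∑ ω, p ω * ∑ l, Real.logb 2 (k (e ω) l (A l ω) (B l ω)) ≤
      Real.logb 2 (Fintype.card μ) := by
  let c (l : ι) (ω : Ω) : ℝ := condProb p (A l) (known A (B l) l) (A l ω) (known A (B l) l ω)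
  let F (m : μ) (ω : Ω) : ℝ := ∏ l, k m l (A l ω) (B l ω) / c l ω
  have hc : ∀ l ω, 0 < p ω → 0 < c l ω := fun l _ => condProb_pos hp.1 (A l) (known A (B l) l)
  have hF : ∀ m ω, 0 ≤ F m ω := fun m ω => Finset.prod_nonneg fun l _ =>
    div_nonneg (hk _ _ _ _).le (condProb_nonneg hp.1 _ _ _ _)
  have hFe : ∑ ω, p ω * F (e ω) ω ≤ Fintype.card μ :=
    calc ∑ ω, p ω * F (e ω) ω ≤ ∑ ω, ∑ m, p ω * F m ω :=
          Finset.sum_le_sum fun ω _ => Finset.single_le_sum (f := fun m => p ω * F m ω)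
            (fun m _ => mul_nonneg (hp.1 ω) (hF m ω)) (Finset.mem_univ _)
      _ = ∑ m, ∑ ω, p ω * F m ω := Finset.sum_comm
      _ ≤ ∑ _m : μ, 1 := Finset.sum_le_sum fun m _ =>
          sum_mul_prod_div_condProb_le hp hM (fun l a b => (hk m l a b).le) (hk1 m) Finset.univ
      _ = Fintype.card μ := by simp
  have hlog := sum_mul_logb_le_logb hp (F := fun ω => F (e ω) ω)
    (fun ω hω => Finset.prod_pos fun l _ => div_pos (hk _ _ _ _) (hc l ω hω)) hFe
  refine le_of_eq_of_le ?_ hlog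
  simp only [condEntropy_eq_sum, ← Finset.sum_neg_distrib]
  rw [Finset.sum_comm, ← Finset.sum_add_distrib]
  refine Finset.sum_congr rfl fun ω _ => ?_
  rcases (hp.1 ω).eq_or_lt with h | h
  · simp [← h]
  · rw [Real.logb_prod _ _ fun l _ => (div_pos (hk _ _ _ _) (hc l ω h)).ne', Finset.mul_sum,
      Finset.mul_sum, ← Finset.sum_add_distrib]
    refine Finset.sum_congr rfl fun l _ => ?_
    rw [Real.logb_div (hk _ _ _ _).ne' (hc l ω h).ne']
    ring

theorem condEntropy_known_anti [Fintype ι] [∀ l, Fintype (α l)] [∀ l, Fintype (β l)]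
    (hp : p ∈ stdSimplex ℝ Ω) {k l : ι} (hkl : k < l)
    (h : IsMarkov p (A k) (known A (B l) k) (before B l)) :
    condEntropy p (A k) (known A (B l) k) ≤ condEntropy p (A k) (known A (B k) k) := by
  rw [← h.condEntropy_eq hp.1]
  exact condEntropy_le_condEntropy_comp hp (A k)
    (fun ω => (known A (B l) k ω, before B l ω)) fun x => (x.1.1, x.2 ⟨k, hkl⟩)

section Block

variable {κ : Type*}

/-- The reshaping of a block of values of `known A B l` into a value of `known` on blocks. -/
def knownArrowEquiv (α : ι → Type*) (β κ : Type*) (l : ι) :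
    (κ → (∀ j : {j // j < l}, α j) × β) ≃ (∀ j : {j // j < l}, κ → α j) × (κ → β) :=
  (Equiv.arrowProdEquivProdArrow κ _ _).trans ((Equiv.piComm _).prodCongr (Equiv.refl _))

variable [Fintype κ] [DecidableEq κ]

theorem isMarkov_known_block (hp : ∀ ω, 0 ≤ p ω) {l : ι}
    (h : IsMarkov p (A l) (known A (B l) l) (before B l)) :
    IsMarkov (block p) (fun s : κ → Ω => A l ∘ s)
      (known (fun j s => A j ∘ s) (fun s => B l ∘ s) l) (before (fun j s => B j ∘ s) l) :=
  (h.block hp).comp_equiv (knownArrowEquiv α (β l) κ l) (Equiv.piComm _)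

theorem condEntropy_known_block [Fintype ι] [∀ l, Fintype (α l)] {β : Type*} [Fintype β]
    (hp : p ∈ stdSimplex ℝ Ω) (A : ∀ l, Ω → α l) (B : Ω → β) (l : ι) :
    condEntropy (block p) (fun s : κ → Ω => A l ∘ s)
        (known (fun j s => A j ∘ s) (fun s => B ∘ s) l) =
      Fintype.card κ * condEntropy p (A l) (known A B l) :=
  (condEntropy_comp_equiv (block p) (fun s => A l ∘ s) (fun s => known A B l ∘ s)
    (knownArrowEquiv α β κ l)).trans (condEntropy_block hp (A l) (known A B l))

end Block

end Chain

section Converse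

open Filter Topology

open Classical in
/-- The symmetric channel on `α` with error parameter `δ`. It is only a subprobability kernel, the
mass `δ` being divided by the size of `α` rather than by the number of wrong symbols. -/
def fanoKernel {α : Type*} [Fintype α] (δ : ℝ) (a b : α) : ℝ :=
  if a = b then 1 - δ else δ / Fintype.card α

theorem fanoKernel_pos {α : Type*} [Fintype α] {δ : ℝ} (h0 : 0 < δ) (h1 : δ < 1) (a b : α) :
    0 < fanoKernel δ a b := by
  have hcard : (0 : ℝ) < Fintype.card α := Nat.cast_pos.2 (Fintype.card_pos_iff.2 ⟨a⟩)
  rw [fanoKernel]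
  split_ifs
  · exact sub_pos.2 h1
  · positivity

theorem sum_fanoKernel_le_one {α : Type*} [Fintype α] {δ : ℝ} (h0 : 0 < δ) (b : α) :
    ∑ a, fanoKernel δ a b ≤ 1 := by
  classical
  have hcard : (0 : ℝ) < Fintype.card α := Nat.cast_pos.2 (Fintype.card_pos_iff.2 ⟨b⟩)
  have hδ : 0 ≤ δ / Fintype.card α := by positivity
  calc ∑ a, fanoKernel δ a b ≤ ∑ a, ((if a = b then 1 - δ else 0) + δ / Fintype.card α) := by
        refine Finset.sum_le_sum fun a _ => ?_
        rw [fanoKernel]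
        split_ifs <;> linarith
    _ = 1 := by
        simp only [Finset.sum_add_distrib, Finset.sum_ite_eq', Finset.mem_univ, if_true,
          Finset.sum_const, Finset.card_univ, nsmul_eq_mul]
        field_simp
        ring

theorem sum_prod_fanoKernel_le_one {α ι : Type*} [Fintype α] [Fintype ι] [DecidableEq ι] {δ : ℝ}
    (h0 : 0 < δ) (h1 : δ < 1) (b : ι → α) : ∑ a : ι → α, ∏ i, fanoKernel δ (a i) (b i) ≤ 1 := by
  rw [← Fintype.prod_sum fun i a => fanoKernel δ a (b i)]
  exact Finset.prod_le_one (fun i _ => Finset.sum_nonneg fun a _ => (fanoKernel_pos h0 h1 _ _).le)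
    fun i _ => sum_fanoKernel_le_one h0 _

variable {t : ℕ} {W Y : Fin t → Type*}

/-- The source symbol `W_l`. -/
def source (l : Fin t) (ω : (∀ l, W l) × (∀ l, Y l)) : W l := ω.1 l

/-- The side-information symbol `Y_l`. -/
def side (l : Fin t) (ω : (∀ l, W l) × (∀ l, Y l)) : Y l := ω.2 l

variable [∀ l, Fintype (W l)]

theorem le_logb_fanoKernel {δ : ℝ} (h0 : 0 < δ) (h1 : δ < 1) {l : Fin t} (w : ∀ k, W k)
    (v : W l) :
    Real.logb 2 (1 - δ) + symbolError l w v * (Real.logb 2 δ - Real.logb 2 (Fintype.card (W l))) ≤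
      Real.logb 2 (fanoKernel δ (w l) v) := by
  have hcard : (Fintype.card (W l) : ℝ) ≠ 0 :=
    Nat.cast_ne_zero.2 (Fintype.card_pos_iff.2 ⟨v⟩).ne'
  have hlog : Real.logb 2 (1 - δ) ≤ 0 :=
    Real.logb_nonpos one_lt_two (sub_nonneg.2 h1.le) (sub_le_self _ h0.le)
  rw [fanoKernel, symbolError, ← Real.logb_div h0.ne' hcard]
  split_ifs <;> linarith

variable [∀ l, Fintype (Y l)] {q : (∀ l, W l) × (∀ l, Y l) → ℝ}

theorem le_sum_logb_fanoKernel (hq : q ∈ stdSimplex ℝ ((∀ l, W l) × (∀ l, Y l))) {n : ℕ}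
    (hn : n ≠ 0) (c : Code (∀ l, W l) Y W n) {δ : ℝ} (h0 : 0 < δ) (h1 : δ < 1) (l : Fin t) :
    n * (Real.logb 2 (1 - δ) +
        c.distortion q symbolError l * (Real.logb 2 δ - Real.logb 2 (Fintype.card (W l)))) ≤
      ∑ s, block q s * ∑ i, Real.logb 2 (fanoKernel δ ((s i).1 l)
        (c.replica l (fun j => (s j).1) (fun j => (s j).2 l) i)) := by
  have hn' : (n : ℝ) ≠ 0 := Nat.cast_ne_zero.2 hn
  refine le_of_eq_of_le ?_ (Finset.sum_le_sum fun s _ => mul_le_mul_of_nonneg_left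
    (Finset.sum_le_sum fun i _ => le_logb_fanoKernel h0 h1 (s i).1 _) (block_nonneg hq.1 s))
  simp only [Finset.sum_add_distrib, ← Finset.sum_mul, mul_add, Finset.sum_const, Finset.card_univ,
    Fintype.card_fin, nsmul_eq_mul, (block_mem_stdSimplex hq).2, one_mul, Code.distortion,
    ← mul_assoc]
  congr 2
  rw [Finset.mul_sum]
  refine Finset.sum_congr rfl fun s _ => ?_
  rw [block]
  field_simp

theorem Code.sum_le_sum_rate (hq : q ∈ stdSimplex ℝ ((∀ l, W l) × (∀ l, Y l)))
    (hM : ∀ l, IsMarkov q (source l) (known source (side l) l) (before side l)) {n : ℕ}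
    (hn : n ≠ 0) (c : Code (∀ l, W l) Y W n) {δ : ℝ} (h0 : 0 < δ) (h1 : δ < 1) :
    ∑ l, (condEntropy q (source l) (known source (side l) l) + (Real.logb 2 (1 - δ) +
        c.distortion q symbolError l * (Real.logb 2 δ - Real.logb 2 (Fintype.card (W l))))) ≤
      ∑ l, c.rate l := by
  have hn' : (n : ℝ) ≠ 0 := Nat.cast_ne_zero.2 hn
  have hn0 : (0 : ℝ) < n := Nat.cast_pos.2 hn.bot_lt
  obtain ⟨ω, -⟩ := exists_pos_of_mem_stdSimplex hq
  let k (m : ∀ l, Fin (c.m l)) (l : Fin t) (w : Fin n → W l) (y : Fin n → Y l) : ℝ :=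
    ∏ i, fanoKernel δ (w i) (c.dec l (fun k => m k) y i)
  have hconv := sum_condEntropy_add_le_logb_card (block_mem_stdSimplex hq)
    (fun l => isMarkov_known_block hq.1 (hM l)) (fun s => c.enc fun i => (s i).1)
    (fun m l w y => Finset.prod_pos fun i _ => fanoKernel_pos h0 h1 _ _)
    (k := k) fun _ _ _ => sum_prod_fanoKernel_le_one h0 h1 _
  have hrate : Real.logb 2 (Fintype.card (∀ l, Fin (c.m l))) = n * ∑ l, c.rate l := by
    have hm : ∀ l, (c.m l : ℝ) ≠ 0 := fun l =>
      Nat.cast_ne_zero.2 (Fin.pos (c.enc (fun _ => ω.1) l)).ne'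
    simp only [Fintype.card_pi, Fintype.card_fin, Nat.cast_prod, Code.rate, Finset.mul_sum]
    rw [Real.logb_prod _ _ fun l _ => hm l]
    exact Finset.sum_congr rfl fun l _ => by field_simp
  refine le_of_mul_le_mul_left ?_ hn0
  rw [← hrate]
  refine le_trans ?_ hconv
  simp only [Finset.mul_sum (s := Finset.univ (α := Fin t))]
  rw [Finset.sum_comm, ← Finset.sum_add_distrib]
  refine Finset.sum_le_sum fun l _ => ?_
  rw [condEntropy_known_block hq source (side l) l, Fintype.card_fin, mul_add]
  refine add_le_add_right ((le_sum_logb_fanoKernel hq hn c h0 h1 l).trans (le_of_eq ?_)) _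
  refine Finset.sum_congr rfl fun s _ => ?_
  rw [Real.logb_prod _ _ fun i _ => (fanoKernel_pos h0 h1 _ _).ne']
  rfl

theorem sum_fano_le_of_mem_singleChannelRates (hq : q ∈ stdSimplex ℝ ((∀ l, W l) × (∀ l, Y l)))
    (hM : ∀ l, IsMarkov q (source l) (known source (side l) l) (before side l)) {r : ℝ}
    (hr : r ∈ singleChannelRates q symbolError 0) {ε : ℝ} (h0 : 0 < ε) (h1 : ε < 1) :
    ∑ l, (condEntropy q (source l) (known source (side l) l) + (Real.logb 2 (1 - ε) +
        ε * (Real.logb 2 ε - Real.logb 2 (Fintype.card (W l))))) ≤ r + t * ε := by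
  obtain ⟨hr0, -, hadm⟩ := hr
  obtain ⟨n, hn, c, hdist, hrate⟩ := hadm ε h0
  have hsum : ∑ l : Fin t, (if (l : ℕ) = 0 then r else 0) ≤ r := by
    cases t with
    | zero => simpa using hr0
    | succ t => simp
  calc ∑ l, (condEntropy q (source l) (known source (side l) l) + (Real.logb 2 (1 - ε) +
        ε * (Real.logb 2 ε - Real.logb 2 (Fintype.card (W l)))))
      ≤ ∑ l, (condEntropy q (source l) (known source (side l) l) + (Real.logb 2 (1 - ε) +
          c.distortion q symbolError l *
            (Real.logb 2 ε - Real.logb 2 (Fintype.card (W l))))) := by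
        refine Finset.sum_le_sum fun l _ => ?_
        have hlog : Real.logb 2 ε - Real.logb 2 (Fintype.card (W l)) ≤ 0 :=
          sub_nonpos.2 ((Real.logb_nonpos one_lt_two h0.le h1.le).trans
            (div_nonneg (Real.log_natCast_nonneg _) (Real.log_pos one_lt_two).le))
        gcongr _ + (_ + ?_)
        exact mul_le_mul_of_nonpos_right (by simpa using hdist l) hlog
    _ ≤ ∑ l, c.rate l := c.sum_le_sum_rate hq hM hn.ne' h0 h1
    _ ≤ ∑ l : Fin t, ((if (l : ℕ) = 0 then r else 0) + ε) := Finset.sum_le_sum fun l _ => hrate l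
    _ ≤ r + t * ε := by
        rw [Finset.sum_add_distrib, Finset.sum_const, Finset.card_univ, Fintype.card_fin,
          nsmul_eq_mul]
        exact add_le_add_left hsum _

theorem sum_condEntropy_le_of_mem_singleChannelRates
    (hq : q ∈ stdSimplex ℝ ((∀ l, W l) × (∀ l, Y l)))
    (hM : ∀ l, IsMarkov q (source l) (known source (side l) l) (before side l)) {r : ℝ}
    (hr : r ∈ singleChannelRates q symbolError 0) :
    ∑ l, condEntropy q (source l) (known source (side l) l) ≤ r := by
  have hlog : Tendsto (fun ε : ℝ => Real.logb 2 (1 - ε)) (𝓝 0) (𝓝 0) := by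
    have h : ContinuousAt (fun ε : ℝ => Real.logb 2 (1 - ε)) 0 :=
      ((continuousAt_const.sub continuousAt_id).log (by norm_num)).div_const _
    simpa using h.tendsto
  have hmul (C : ℝ) : Tendsto (fun ε : ℝ => ε * (Real.logb 2 ε - C)) (𝓝 0) (𝓝 0) := by
    have h : Continuous fun ε : ℝ => ε * Real.log ε / Real.log 2 - ε * C :=
      (Real.continuous_mul_log.div_const _).sub (continuous_mul_const C)
    simpa [Real.logb, mul_sub, mul_div_assoc] using h.tendsto 0
  have hleft := tendsto_finsetSum Finset.univ fun l (_ : l ∈ Finset.univ) =>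
    (tendsto_const_nhds (x := condEntropy q (source l) (known source (side l) l))).add
      (hlog.add (hmul (Real.logb 2 (Fintype.card (W l)))))
  have hright : Tendsto (fun ε : ℝ => r + t * ε) (𝓝 0) (𝓝 r) := by
    have h : Continuous fun ε : ℝ => r + t * ε := by fun_prop
    simpa using h.tendsto 0
  simp only [add_zero] at hleft
  refine le_of_tendsto_of_tendsto (b := 𝓝[>] 0) (hleft.mono_left nhdsWithin_le_nhds)
    (hright.mono_left nhdsWithin_le_nhds) ?_
  filter_upwards [Ioo_mem_nhdsGT one_pos] with ε hε
  exact sum_fano_le_of_mem_singleChannelRates hq hM hr hε.1 hε.2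

end Converse

section Binning

variable {α ν : Type*}

/-- Under the binning `f`, the point `a` shares its bin with another point of the set `T`. -/
def Collides (f : α → ν) (T : α → Prop) (a : α) : Prop :=
  ∃ b, b ≠ a ∧ f b = f a ∧ T b

variable [Fintype α] [Fintype ν]

open Classical in
/-- A map `f` with `f a = f b` may be redefined at `a` in any way without losing information. -/
theorem card_filter_apply_eq_apply_mul_le {a b : α} (hab : a ≠ b) :
    Finset.card {f : α → ν | f a = f b} * Fintype.card ν ≤ Fintype.card (α → ν) := by
  rw [← Fintype.card_subtype, ← Fintype.card_prod]
  refine Fintype.card_le_of_injective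
    (fun x : {f : α → ν // f a = f b} × ν => Function.update x.1.1 a x.2) ?_
  rintro ⟨⟨f, hf⟩, v⟩ ⟨⟨g, hg⟩, w⟩ h
  have hne : ∀ x, x ≠ a → f x = g x := fun x hx => by simpa [hx] using congrFun h x
  have hv : v = w := by simpa using congrFun h a
  have hfg : f = g := by
    funext x
    by_cases hx : x = a
    · rw [hx, hf, hg, hne b hab.symm]
    · exact hne x hx
  simp only [hfg, hv]

open Classical in
theorem card_collides_mul_le (T : α → Prop) (a : α) :
    Finset.card {f : α → ν | Collides f T a} * Fintype.card ν ≤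
      Finset.card {b | T b} * Fintype.card (α → ν) := by
  have hsub : ({f : α → ν | Collides f T a} : Finset _) ⊆
      Finset.biUnion {b | T b ∧ b ≠ a} fun b => {f : α → ν | f b = f a} := fun f hf => by
    obtain ⟨b, hb, hfb, hT⟩ := (Finset.mem_filter.1 hf).2
    simpa using ⟨b, ⟨hT, hb⟩, hfb⟩
  calc Finset.card {f : α → ν | Collides f T a} * Fintype.card ν
      ≤ (∑ b with T b ∧ b ≠ a, Finset.card {f : α → ν | f b = f a}) * Fintype.card ν :=
        Nat.mul_le_mul_right _ ((Finset.card_le_card hsub).trans Finset.card_biUnion_le)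
    _ ≤ Finset.card {b | T b ∧ b ≠ a} * Fintype.card (α → ν) := by
        rw [Finset.sum_mul]
        exact Finset.sum_le_card_nsmul _ _ _ fun b hb =>
          card_filter_apply_eq_apply_mul_le (Finset.mem_filter.1 hb).2.2
    _ ≤ Finset.card {b | T b} * Fintype.card (α → ν) :=
        Nat.mul_le_mul_right _ (Finset.card_le_card fun b hb => by simp_all)

open Classical in
/-- Random binning: a uniformly chosen `f : α → ν` satisfies the bound on average. -/
theorem exists_binning [Nonempty ν] {Ω κ : Type*} [Fintype Ω] [Fintype κ] {p : Ω → ℝ}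
    (hp : p ∈ stdSimplex ℝ Ω) (A : Ω → α) (T : κ → Ω → α → Prop) {K : ℝ}
    (hT : ∀ l ω, (Finset.card {a | T l ω a} : ℝ) ≤ K) :
    ∃ f : α → ν, ∑ l, prob p (fun ω => Collides f (T l ω) (A ω)) ≤
      Fintype.card κ * (K / Fintype.card ν) := by
  have hν : (0 : ℝ) < Fintype.card ν := Nat.cast_pos.2 Fintype.card_pos
  have hcard : ∀ l ω, (Finset.card {f : α → ν | Collides f (T l ω) (A ω)} : ℝ) ≤
      Fintype.card (α → ν) * (K / Fintype.card ν) := fun l ω => by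
    rw [← mul_div_assoc, le_div_iff₀ hν, mul_comm (Fintype.card (α → ν) : ℝ)]
    exact le_trans (mod_cast card_collides_mul_le (T l ω) (A ω))
      (mul_le_mul_of_nonneg_right (hT l ω) (Nat.cast_nonneg _))
  have hsum : ∀ l, ∑ f : α → ν, prob p (fun ω => Collides f (T l ω) (A ω)) ≤
      Fintype.card (α → ν) * (K / Fintype.card ν) := fun l =>
    calc ∑ f : α → ν, prob p (fun ω => Collides f (T l ω) (A ω))
        = ∑ ω, p ω * Finset.card {f : α → ν | Collides f (T l ω) (A ω)} := by
          simp only [prob_eq_sum_ite]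
          rw [Finset.sum_comm]
          refine Finset.sum_congr rfl fun ω _ => ?_
          rw [← Finset.sum_filter, Finset.sum_const, nsmul_eq_mul, mul_comm]
      _ ≤ ∑ ω, p ω * (Fintype.card (α → ν) * (K / Fintype.card ν)) :=
          Finset.sum_le_sum fun ω _ => mul_le_mul_of_nonneg_left (hcard l ω) (hp.1 ω)
      _ = Fintype.card (α → ν) * (K / Fintype.card ν) := by
          rw [← Finset.sum_mul, hp.2, one_mul]
  obtain ⟨f, -, hf⟩ := Finset.exists_le_of_sum_le (s := Finset.univ)
    (f := fun f : α → ν => ∑ l, prob p (fun ω => Collides f (T l ω) (A ω)))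
    (g := fun _ => Fintype.card κ * (K / Fintype.card ν)) Finset.univ_nonempty <| by
      rw [Finset.sum_comm]
      refine (Finset.sum_le_sum fun l _ => hsum l).trans (le_of_eq ?_)
      simp only [Finset.sum_const, Finset.card_univ, nsmul_eq_mul]
      ring
  exact ⟨f, hf⟩

end Binning

section Typicality

open Filter Topology

variable {Ω α β : Type*} [Fintype Ω] {p : Ω → ℝ}

/-- The function `u ↦ 𝔼 exp (u x)` has value `1` and derivative `𝔼 x < 0` at `u = 0`. -/
theorem exists_sum_mul_exp_lt_one (hp : p ∈ stdSimplex ℝ Ω) {x : Ω → ℝ}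
    (hx : ∑ ω, p ω * x ω < 0) : ∃ u > 0, ∑ ω, p ω * Real.exp (u * x ω) < 1 := by
  have hderiv : HasDerivAt (fun u : ℝ => ∑ ω, p ω * Real.exp (u * x ω)) (∑ ω, p ω * x ω) 0 := by
    refine HasDerivAt.fun_sum fun ω _ => ?_
    have hexp := ((hasDerivAt_id (0 : ℝ)).mul_const (x ω)).exp
    simpa using hexp.const_mul (p ω)
  have hslope := (hasDerivAt_iff_tendsto_slope.1 hderiv).mono_left
    (nhdsWithin_mono 0 fun u (hu : 0 < u) => hu.ne')
  obtain ⟨u, hu, hlt⟩ := ((eventually_mem_nhdsWithin (a := (0 : ℝ)) (s := Set.Ioi 0)).and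
    (hslope.eventually_lt_const hx)).exists
  refine ⟨u, hu, ?_⟩
  rw [slope_def_field, sub_zero, div_lt_iff₀ hu, zero_mul, sub_neg] at hlt
  simpa [hp.2] using hlt

theorem prob_block_sum_nonneg_le {ι : Type*} [Fintype ι] [DecidableEq ι] (hp : ∀ ω, 0 ≤ p ω)
    (x : Ω → ℝ) {u : ℝ} (hu : 0 ≤ u) :
    prob (block p) (fun s : ι → Ω => 0 ≤ ∑ i, x (s i)) ≤
      (∑ ω, p ω * Real.exp (u * x ω)) ^ Fintype.card ι := by
  classical
  rw [prob_eq_sum_ite, ← Finset.card_univ, ← Finset.prod_const, Fintype.prod_sum]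
  refine Finset.sum_le_sum fun s _ => ?_
  rw [Finset.prod_mul_distrib, ← Real.exp_sum, ← Finset.mul_sum, ← block]
  split_ifs with hs
  · exact le_mul_of_one_le_right (block_nonneg hp s) (Real.one_le_exp (mul_nonneg hu hs))
  · exact mul_nonneg (block_nonneg hp s) (Real.exp_nonneg _)

theorem tendsto_prob_block_sum_nonneg (hp : p ∈ stdSimplex ℝ Ω) {x : Ω → ℝ}
    (hx : ∑ ω, p ω * x ω < 0) :
    Tendsto (fun n : ℕ => prob (block p) (fun s : Fin n → Ω => 0 ≤ ∑ i, x (s i))) atTop (𝓝 0) := by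
  obtain ⟨u, hu, hlt⟩ := exists_sum_mul_exp_lt_one hp hx
  have hpow := tendsto_pow_atTop_nhds_zero_of_lt_one
    (Finset.sum_nonneg fun ω _ => mul_nonneg (hp.1 ω) (Real.exp_nonneg (u * x ω))) hlt
  refine squeeze_zero (fun n => Finset.sum_nonneg fun s _ => block_nonneg hp.1 s) (fun n => ?_) hpow
  simpa using prob_block_sum_nonneg_le (ι := Fin n) hp.1 x hu.le

variable {ι : Type*} [Fintype ι]

/-- The threshold test for the block `a` as a value of copies of `A`, given the block `b` of values
of copies of `B`. It replaces joint typicality. -/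
def IsLikely (p : Ω → ℝ) (A : Ω → α) (B : Ω → β) (θ : ℝ) (b : ι → β) (a : ι → α) : Prop :=
  (2 : ℝ) ^ (-(Fintype.card ι * θ)) ≤ ∏ i, condProb p A B (a i) (b i)

open Classical in
theorem card_isLikely_le [DecidableEq ι] [Fintype α] (hp : ∀ ω, 0 ≤ p ω) (A : Ω → α) (B : Ω → β)
    (θ : ℝ) (b : ι → β) :
    (Finset.card {a | IsLikely p A B θ b a} : ℝ) ≤ (2 : ℝ) ^ (Fintype.card ι * θ) := by
  have hprod : ∀ a : ι → α, 0 ≤ ∏ i, condProb p A B (a i) (b i) := fun a =>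
    Finset.prod_nonneg fun i _ => condProb_nonneg hp _ _ _ _
  have hcard : (Finset.card {a | IsLikely p A B θ b a} : ℝ) * 2 ^ (-(Fintype.card ι * θ)) ≤ 1 :=
    calc (Finset.card {a | IsLikely p A B θ b a} : ℝ) * 2 ^ (-(Fintype.card ι * θ))
        = ∑ a with IsLikely p A B θ b a, (2 : ℝ) ^ (-(Fintype.card ι * θ)) := by
          rw [Finset.sum_const, nsmul_eq_mul]
      _ ≤ ∑ a with IsLikely p A B θ b a, ∏ i, condProb p A B (a i) (b i) :=
          Finset.sum_le_sum fun a ha => (Finset.mem_filter.1 ha).2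
      _ ≤ ∑ a : ι → α, ∏ i, condProb p A B (a i) (b i) := Finset.sum_le_univ_sum_of_nonneg hprod
      _ = ∏ i, ∑ a, condProb p A B a (b i) :=
          (Fintype.prod_sum fun i a => condProb p A B a (b i)).symm
      _ ≤ 1 := Finset.prod_le_one
          (fun i _ => Finset.sum_nonneg fun a _ => condProb_nonneg hp _ _ _ _)
          fun i _ => sum_condProb_le_one _ _ _ _
  rwa [Real.rpow_neg two_pos.le, ← div_eq_mul_inv, div_le_one (by positivity)] at hcard

theorem tendsto_prob_not_isLikely [Fintype α] [Fintype β] (hp : p ∈ stdSimplex ℝ Ω) {A : Ω → α}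
    {B : Ω → β} {θ : ℝ} (hθ : condEntropy p A B < θ) :
    Tendsto (fun n : ℕ => prob (block p) fun s : Fin n → Ω => ¬ IsLikely p A B θ (B ∘ s) (A ∘ s))
      atTop (𝓝 0) := by
  have hx : ∑ ω, p ω * (-Real.logb 2 (condProb p A B (A ω) (B ω)) - θ) < 0 := by
    simpa [mul_sub, ← Finset.sum_mul, hp.2, ← condEntropy_eq_sum] using hθ
  refine squeeze_zero (fun n => Finset.sum_nonneg fun s _ => block_nonneg hp.1 s) (fun n => ?_)
    (tendsto_prob_block_sum_nonneg hp hx)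
  refine prob_mono (block_nonneg hp.1) fun s hs hlikely => ?_
  have hc : ∀ i, 0 < condProb p A B (A (s i)) (B (s i)) := fun i =>
    condProb_pos hp.1 A B (pos_of_block_pos hp.1 hs i)
  simp only [IsLikely, not_le, Function.comp_apply] at hlikely
  rw [← Real.logb_lt_iff_lt_rpow one_lt_two (Finset.prod_pos fun i _ => hc i),
    Real.logb_prod _ _ fun i _ => (hc i).ne', Fintype.card_fin] at hlikely
  simp only [Finset.sum_sub_distrib, Finset.sum_neg_distrib, Finset.sum_const, Finset.card_univ,
    Fintype.card_fin, nsmul_eq_mul]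
  linarith

/-- The error event of decoding the block of values of `A` from its bin under `f` and the block of
values of `B`: the true block fails the threshold test or another block of its bin passes it. -/
def IsAmbiguous {ν : Type*} (p : Ω → ℝ) (A : Ω → α) (B : Ω → β) (θ : ℝ) (f : (ι → α) → ν)
    (s : ι → Ω) : Prop :=
  ¬ IsLikely p A B θ (B ∘ s) (A ∘ s) ∨ Collides f (IsLikely p A B θ (B ∘ s)) (A ∘ s)

theorem rpow_div_natCeil_rpow_le (n : ℕ) (θ R : ℝ) :
    (2 : ℝ) ^ (n * θ) / ⌈(2 : ℝ) ^ (n * R)⌉₊ ≤ ((2 : ℝ) ^ (θ - R)) ^ n := by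
  rw [← Real.rpow_mul_natCast two_pos.le, sub_mul, Real.rpow_sub two_pos, mul_comm θ, mul_comm R]
  exact div_le_div_of_nonneg_left (by positivity) (by positivity) (Nat.le_ceil _)

theorem eventually_exists_binning [Fintype α] {κ : Type*} [Finite κ] {β : κ → Type*}
    [∀ l, Fintype (β l)] (hp : p ∈ stdSimplex ℝ Ω) {A : Ω → α} {B : ∀ l, Ω → β l} {θ R : ℝ}
    (hθ : ∀ l, condEntropy p A (B l) < θ) (hR : θ < R) {ε : ℝ} (hε : 0 < ε) :
    ∀ᶠ n : ℕ in atTop, ∃ f : (Fin n → α) → Fin ⌈(2 : ℝ) ^ (n * R)⌉₊,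
      ∀ l, prob (block p) (IsAmbiguous p A (B l) θ f) ≤ ε := by
  have := Fintype.ofFinite κ
  have hlikely := eventually_all.2 fun l =>
    (tendsto_prob_not_isLikely hp (hθ l)).eventually_le_const (half_pos hε)
  have hpow : Tendsto (fun n : ℕ => Fintype.card κ * ((2 : ℝ) ^ (θ - R)) ^ n) atTop (𝓝 0) := by
    simpa using (tendsto_pow_atTop_nhds_zero_of_lt_one (Real.rpow_nonneg two_pos.le _)
      (Real.rpow_lt_one_of_one_lt_of_neg one_lt_two (sub_neg.2 hR))).const_mul (Fintype.card κ : ℝ)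
  filter_upwards [hlikely, hpow.eventually_le_const (half_pos hε)] with n hn hn'
  have : Nonempty (Fin ⌈(2 : ℝ) ^ (n * R)⌉₊) :=
    Fin.pos_iff_nonempty.1 (Nat.ceil_pos.2 (Real.rpow_pos_of_pos two_pos _))
  obtain ⟨f, hf⟩ := exists_binning (ν := Fin ⌈(2 : ℝ) ^ (n * R)⌉₊)
    (block_mem_stdSimplex (ι := Fin n) hp) (A ∘ ·) (fun l s => IsLikely p A (B l) θ (B l ∘ s))
    (fun l s => card_isLikely_le hp.1 A (B l) θ (B l ∘ s))
  refine ⟨f, fun l => (prob_or_le (block_nonneg hp.1) _ _).trans ?_⟩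
  have hcollides : prob (block p) (fun s => Collides f (IsLikely p A (B l) θ (B l ∘ s)) (A ∘ s)) ≤
      ε / 2 :=
    calc _ ≤ ∑ l, prob (block p) (fun s => Collides f (IsLikely p A (B l) θ (B l ∘ s)) (A ∘ s)) :=
          Finset.single_le_sum (f := fun l => prob (block p) fun s =>
            Collides f (IsLikely p A (B l) θ (B l ∘ s)) (A ∘ s))
            (fun l _ => Finset.sum_nonneg fun s _ => block_nonneg hp.1 s) (Finset.mem_univ l)
      _ ≤ Fintype.card κ * ((2 : ℝ) ^ (n * θ) / ⌈(2 : ℝ) ^ (n * R)⌉₊) := by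
          simpa only [Fintype.card_fin] using hf
      _ ≤ ε / 2 := (mul_le_mul_of_nonneg_left (rpow_div_natCeil_rpow_le n θ R)
          (Nat.cast_nonneg _)).trans hn'
  linarith [hn l]

end Typicality

section Achievability

open Filter Topology

variable {t : ℕ}

theorem exists_code_single_channel {X : Type*} {Y Xhat : Fin t → Type*} {n M : ℕ}
    (enc : (Fin n → X) → Fin M) (dec : ∀ l, Fin M → (Fin n → Y l) → Fin n → Xhat l) :
    ∃ c : Code X Y Xhat n, (∀ l, c.m l = if (l : ℕ) = 0 then M else 1) ∧
      ∀ l x y, c.replica l x y = dec l (enc x) y := by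
  refine ⟨⟨fun l => if (l : ℕ) = 0 then M else 1,
    fun x l => ⟨if (l : ℕ) = 0 then enc x else 0, by split_ifs <;> simp⟩,
    fun l msg => dec l ⟨msg ⟨⟨0, l.pos⟩, Nat.zero_le _⟩, by
      simpa using (msg ⟨⟨0, l.pos⟩, Nat.zero_le _⟩).2⟩⟩, fun l => rfl, fun l x y => ?_⟩
  simp [Code.replica]

variable {W Y : Fin t → Type*} [∀ l, Fintype (W l)] [∀ l, Fintype (Y l)]
  {q : (∀ l, W l) × (∀ l, Y l) → ℝ} {n : ℕ}

theorem Code.distortion_symbolError_le (hq : ∀ ω, 0 ≤ q ω) (c : Code (∀ l, W l) Y W n)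
    (l : Fin t) :
    c.distortion q symbolError l ≤
      prob (block q) fun s => c.replica l (fun i => (s i).1) (side l ∘ s) ≠ source l ∘ s := by
  classical
  rw [prob_eq_sum_ite]
  refine Finset.sum_le_sum fun s _ => ?_
  split_ifs with hs
  · have hle : ∑ i, symbolError l (s i).1 (c.replica l (fun j => (s j).1) (side l ∘ s) i) ≤ n := by
      refine (Finset.sum_le_card_nsmul _ _ 1 fun i _ => ?_).trans (by simp)
      rw [symbolError]
      split_ifs <;> norm_num
    refine mul_le_of_le_one_right (block_nonneg hq s) ?_
    rw [one_div_mul_eq_div]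
    exact div_le_one_of_le₀ hle (Nat.cast_nonneg n)
  · rw [not_ne_iff] at hs
    have hzero : ∀ i, symbolError l (s i).1 (c.replica l (fun j => (s j).1) (side l ∘ s) i) = 0 :=
      fun i => if_pos (congrFun hs i).symm
    exact (mul_eq_zero_of_right _ <| mul_eq_zero_of_right _ <|
      Finset.sum_eq_zero fun i _ => hzero i).le

/-- The block `s` is consistent with all that decoder `l` observes, namely the bins `b` under the
binnings `f` and the side-information `y`, and its components `W_k`, `k ≤ l`, pass the threshold
tests. -/
def IsCandidate (q : (∀ l, W l) × (∀ l, Y l) → ℝ) (θ : Fin t → ℝ) {M : Fin t → ℕ}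
    (f : ∀ k, (Fin n → W k) → Fin (M k)) (l : Fin t) (b : ∀ k, Fin (M k)) (y : Fin n → Y l)
    (s : Fin n → (∀ l, W l) × (∀ l, Y l)) : Prop :=
  side l ∘ s = y ∧ ∀ k ≤ l, f k (source k ∘ s) = b k ∧
    IsLikely q (source k) (known source (side l) k) (θ k) (known source (side l) k ∘ s)
      (source k ∘ s)

section Candidate

variable {θ : Fin t → ℝ} {M : Fin t → ℕ} {f : ∀ k, (Fin n → W k) → Fin (M k)} {l : Fin t}
  {s : Fin n → (∀ l, W l) × (∀ l, Y l)}

theorem isCandidate_of_not_isAmbiguous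
    (hs : ∀ k ≤ l, ¬ IsAmbiguous q (source k) (known source (side l) k) (θ k) (f k) s) :
    IsCandidate q θ f l (fun k => f k (source k ∘ s)) (side l ∘ s) s :=
  ⟨rfl, fun k hk => ⟨rfl, not_not.1 fun h => hs k hk (Or.inl h)⟩⟩

/-- Successive decoding: once the components before `W_k` are known to agree, so are the conditions
of the threshold test for `W_k`. -/
theorem IsCandidate.source_comp_eq {s' : Fin n → (∀ l, W l) × (∀ l, Y l)}
    (hs : ∀ k ≤ l, ¬ IsAmbiguous q (source k) (known source (side l) k) (θ k) (f k) s)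
    (hs' : IsCandidate q θ f l (fun k => f k (source k ∘ s)) (side l ∘ s) s') (k : Fin t)
    (hk : k ≤ l) : source k ∘ s' = source k ∘ s := by
  induction k using WellFoundedLT.induction with
  | ind k ih =>
    have hknown : known source (side l) k ∘ s' = known source (side l) k ∘ s := funext fun i =>
      Prod.ext (funext fun j => congrFun (ih j j.2 (j.2.le.trans hk)) i) (congrFun hs'.1 i)
    obtain ⟨hbin, hlikely⟩ := hs'.2 k hk
    by_contra hne
    exact hs k hk (Or.inr ⟨_, hne, hbin, hknown ▸ hlikely⟩)

end Candidate

theorem exists_binning_code [Nonempty ((∀ l, W l) × (∀ l, Y l))] (hq : ∀ ω, 0 ≤ q ω)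
    {θ : Fin t → ℝ} {M : Fin t → ℕ} (f : ∀ k, (Fin n → W k) → Fin (M k)) {ε : ℝ}
    (hf : ∀ l, ∀ k ≤ l, prob (block q)
      (IsAmbiguous q (source k) (known source (side l) k) (θ k) (f k)) ≤ ε) :
    ∃ c : Code (∀ l, W l) Y W n, (∀ l, c.m l = if (l : ℕ) = 0 then ∏ k, M k else 1) ∧
      ∀ l, c.distortion q symbolError l ≤ Finset.card {k | k ≤ l} * ε := by
  obtain ⟨c, hm, hreplica⟩ := exists_code_single_channel
    (fun x : Fin n → ∀ k, W k => finPiFinEquiv fun k => f k fun i => x i k)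
    (fun l b y => source l ∘ Classical.epsilon (IsCandidate q θ f l (finPiFinEquiv.symm b) y))
  refine ⟨c, hm, fun l => ?_⟩
  have herror : ∀ s, c.replica l (fun i => (s i).1) (side l ∘ s) ≠ source l ∘ s →
      ∃ k : {k // k ≤ l},
        IsAmbiguous q (source k.1) (known source (side l) k.1) (θ k) (f k) s := fun s => by
    contrapose!
    rw [hreplica, Equiv.symm_apply_apply]
    exact fun hs => (Classical.epsilon_spec ⟨s, isCandidate_of_not_isAmbiguous fun k hk =>
      hs ⟨k, hk⟩⟩).source_comp_eq (fun k hk => hs ⟨k, hk⟩) l le_rfl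
  calc c.distortion q symbolError l
      ≤ prob (block q) fun s => c.replica l (fun i => (s i).1) (side l ∘ s) ≠ source l ∘ s :=
        c.distortion_symbolError_le hq l
    _ ≤ ∑ k : {k // k ≤ l}, prob (block q)
          (IsAmbiguous q (source k.1) (known source (side l) k.1) (θ k) (f k)) :=
        (prob_mono (block_nonneg hq) fun s _ => herror s).trans
          (prob_exists_le (block_nonneg hq) _)
    _ ≤ Finset.card {k | k ≤ l} * ε := by
        rw [← Fintype.card_subtype, ← nsmul_eq_mul]
        exact Finset.sum_le_card_nsmul _ _ _ fun k _ => hf l k k.2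

theorem logb_natCeil_rpow_le {x : ℝ} (hx : 0 ≤ x) : Real.logb 2 ⌈(2 : ℝ) ^ x⌉₊ ≤ x + 1 := by
  have h1 : (1 : ℝ) ≤ 2 ^ x := Real.one_le_rpow one_le_two hx
  have hlt := Nat.ceil_lt_add_one (zero_le_one.trans h1)
  have hpos : (0 : ℝ) < ⌈(2 : ℝ) ^ x⌉₊ := (zero_lt_one.trans_le h1).trans_le (Nat.le_ceil _)
  rw [Real.logb_le_iff_le_rpow one_lt_two hpos, Real.rpow_add_one two_ne_zero]
  linarith

theorem one_div_mul_logb_prod_natCeil_rpow_le {ι : Type*} [Fintype ι] (hn : 0 < n) {R : ι → ℝ}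
    (hR : ∀ k, 0 ≤ R k) :
    1 / (n : ℝ) * Real.logb 2 (∏ k, ⌈(2 : ℝ) ^ (n * R k)⌉₊ : ℕ) ≤
      ∑ k, R k + Fintype.card ι / n := by
  have hn' : (0 : ℝ) < n := Nat.cast_pos.2 hn
  rw [one_div_mul_eq_div, div_le_iff₀ hn', Nat.cast_prod, Real.logb_prod _ _ fun k _ =>
    Nat.cast_ne_zero.2 (Nat.ceil_pos.2 (Real.rpow_pos_of_pos two_pos _)).ne']
  calc ∑ k, Real.logb 2 ⌈(2 : ℝ) ^ (n * R k)⌉₊ ≤ ∑ k, (n * R k + 1) :=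
        Finset.sum_le_sum fun k _ => logb_natCeil_rpow_le (mul_nonneg hn'.le (hR k))
    _ = (∑ k, R k + Fintype.card ι / n) * n := by
        rw [Finset.sum_add_distrib, ← Finset.mul_sum, add_mul, div_mul_cancel₀ _ hn'.ne']
        simp [mul_comm]

theorem eventually_exists_code (hq : q ∈ stdSimplex ℝ ((∀ l, W l) × (∀ l, Y l))) {θ R : Fin t → ℝ}
    (hθ : ∀ l, ∀ k ≤ l, condEntropy q (source k) (known source (side l) k) < θ k)
    (hR : ∀ k, θ k < R k) {ε : ℝ} (hε : 0 < ε) :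
    ∀ᶠ n : ℕ in atTop, ∃ c : Code (∀ l, W l) Y W n, (∀ l, c.distortion q symbolError l ≤ ε) ∧
      ∀ l, c.rate l ≤ if (l : ℕ) = 0 then ∑ k, R k + ε else 0 := by
  obtain ⟨ω, -⟩ := exists_pos_of_mem_stdSimplex hq
  have : Nonempty ((∀ l, W l) × (∀ l, Y l)) := ⟨ω⟩
  have hR0 : ∀ k, 0 ≤ R k := fun k =>
    (condEntropy_nonneg hq.1 _ _).trans ((hθ k k le_rfl).trans (hR k)).le
  have hbin := eventually_all.2 fun k => eventually_exists_binning
    (B := fun l : {l // k ≤ l} => known source (side l.1) k) hq (fun l => hθ l k l.2) (hR k)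
    (show 0 < ε / (t + 1) by positivity)
  filter_upwards [eventually_gt_atTop 0, hbin,
    (tendsto_const_div_atTop_nhds_zero_nat (t : ℝ)).eventually_le_const hε] with n hn hbin hnt
  choose f hf using hbin
  obtain ⟨c, hm, hd⟩ := exists_binning_code hq.1 f fun l k hkl => hf k ⟨l, hkl⟩
  refine ⟨c, fun l => (hd l).trans ?_, fun l => ?_⟩
  · have hcard : (Finset.card {k | k ≤ l} : ℝ) ≤ t + 1 := by
      exact_mod_cast (Finset.card_le_univ _).trans ((Fintype.card_fin t).trans_le t.le_succ)
    calc Finset.card {k | k ≤ l} * (ε / (t + 1)) ≤ (t + 1) * (ε / (t + 1)) := by gcongr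
      _ = ε := mul_div_cancel₀ ε (by positivity)
  · rw [Code.rate, hm]
    split_ifs
    · refine (one_div_mul_logb_prod_natCeil_rpow_le hn hR0).trans ?_
      rw [Fintype.card_fin]
      exact add_le_add_right hnt _
    · simp

theorem sum_condEntropy_mem_singleChannelRates
    (hq : q ∈ stdSimplex ℝ ((∀ l, W l) × (∀ l, Y l)))
    (hH : ∀ l, ∀ k ≤ l, condEntropy q (source k) (known source (side l) k) ≤
      condEntropy q (source k) (known source (side k) k)) :
    ∑ l, condEntropy q (source l) (known source (side l) l) ∈
      singleChannelRates q symbolError 0 := by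
  have hnonneg : 0 ≤ ∑ l, condEntropy q (source l) (known source (side l) l) :=
    Finset.sum_nonneg fun l _ => condEntropy_nonneg hq.1 _ _
  refine ⟨hnonneg, fun l => ?_, fun ε hε => ?_⟩
  · dsimp only
    split_ifs
    exacts [hnonneg, le_rfl]
  set η : ℝ := ε / (4 * (t + 1)) with hη
  have hη0 : 0 < η := by positivity
  have hsum : t * (2 * η) ≤ ε / 2 := by
    rw [hη, ← mul_div_assoc, ← mul_div_assoc, div_le_div_iff₀ (by positivity) two_pos]
    nlinarith
  obtain ⟨n, ⟨c, hd, hrate⟩, hn⟩ := ((eventually_exists_code hq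
    (fun l k hkl => (hH l k hkl).trans_lt (lt_add_of_pos_right _ hη0))
    (fun k => lt_add_of_pos_right _ hη0) (half_pos hε)).and (eventually_gt_atTop 0)).exists
  refine ⟨n, hn, c, fun l => (hd l).trans (by simp [hε.le]), fun l => (hrate l).trans ?_⟩
  dsimp only
  split_ifs
  · simp only [Finset.sum_add_distrib, Finset.sum_const, Finset.card_univ, Fintype.card_fin,
      nsmul_eq_mul]
    linarith
  · simp [hε.le]

end Achievability

section Degraded

variable {t : ℕ} {W Y : Fin t → Type*} [∀ l, Fintype (W l)] [∀ l, Fintype (Y l)]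
  {q : (∀ l, W l) × (∀ l, Y l) → ℝ}

theorem IsDegraded.isMarkov_source (hq : ∀ ω, 0 ≤ q ω) (hdeg : IsDegraded q) (k l : Fin t) :
    IsMarkov q (source k) (known source (side l) k) (before side l) :=
  ((hdeg l).comp_left hq fun x => (x.1 k, fun j : {j // j < k} => x.1 j)).weak_union hq

theorem IsDegraded.condEntropy_anti (hq : q ∈ stdSimplex ℝ ((∀ l, W l) × (∀ l, Y l)))
    (hdeg : IsDegraded q) {k l : Fin t} (hkl : k ≤ l) :
    condEntropy q (source k) (known source (side l) k) ≤
      condEntropy q (source k) (known source (side k) k) := by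
  obtain rfl | hlt := hkl.eq_or_lt
  · exact le_rfl
  · exact condEntropy_known_anti hq hlt (hdeg.isMarkov_source hq.1 k l)

end Degraded

end SideInfo

end

open SideInfo in
theorem corollary4_general {t : ℕ} {W Y : Fin t → Type*} [∀ l, Fintype (W l)] [∀ l, Fintype (Y l)]
    (q : (∀ l, W l) × (∀ l, Y l) → ℝ) (hq : q ∈ stdSimplex ℝ ((∀ l, W l) × (∀ l, Y l)))
    (hM : ∀ l, IsMarkov q (source l) (known source (side l) l) (before side l))
    (hH : ∀ l, ∀ k ≤ l, condEntropy q (source k) (known source (side l) k) ≤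
      condEntropy q (source k) (known source (side k) k)) :
    IsLeast (singleChannelRates q symbolError 0) (rateDistortion q symbolError 0) ∧
      rateDistortion q symbolError 0 =
        ∑ l, condEntropy q (source l) (known source (side l) l) := by
  have hleast : IsLeast (singleChannelRates q symbolError 0)
      (∑ l, condEntropy q (source l) (known source (side l) l)) :=
    ⟨sum_condEntropy_mem_singleChannelRates hq hH,
      fun _ hr => sum_condEntropy_le_of_mem_singleChannelRates hq hM hr⟩
  have heq : rateDistortion q symbolError 0 =
      ∑ l, condEntropy q (source l) (known source (side l) l) := hleast.csInf_eq
  exact ⟨heq ▸ hleast, heq⟩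

theorem corollary4 {t : ℕ} {W Y : Fin t → Type*} [∀ l, Fintype (W l)] [∀ l, Fintype (Y l)]
    (q : (∀ l, W l) × (∀ l, Y l) → ℝ) (hq : q ∈ stdSimplex ℝ ((∀ l, W l) × (∀ l, Y l)))
    (hdeg : SideInfo.IsDegraded q) :
    IsLeast (SideInfo.singleChannelRates q SideInfo.symbolError 0)
        (SideInfo.rateDistortion q SideInfo.symbolError 0) ∧
      SideInfo.rateDistortion q SideInfo.symbolError 0 =
        ∑ l : Fin t, SideInfo.condEntropy q (fun ω => ω.1 l)
          (fun ω => ((fun k : {k : Fin t // k < l} => ω.1 k), ω.2 l)) :=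
  corollary4_general q hq (fun l => hdeg.isMarkov_source hq.1 l l)
    fun _ _ => hdeg.condEntropy_anti hq
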